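/- Let $M,a\in\mathbb N$ with $a>0$, let $g_0,\dots,g_{M-1}\in\ell^2(\mathbb Z)$, and put $g_{m,n}(k)=g_m(k-na)$ for $k,n\in\mathbb Z$. Assume that $\{g_{m,n}\}$ is a frame for $\ell^2(\mathbb Z)$, i.e. there are constants $A,B>0$ with $A\|f\|^2\le\sum_{m,n}|\langle f,g_{m,n}\rangle|^2\le B\|f\|^2$ for all $f\in\ell^2(\mathbb Z)$. Let $Sf=\sum_{m,n}\langle f,g_{m,n}\rangle g_{m,n}$ be its frame operator, $S_{k,l}=\langle Se_l,e_k\rangle$ its matrix entries in the standard basis $(e_k)_{k\in\mathbb Z}$ of $\ell^2(\mathbb Z)$, and $\gamma_m=S^{-1}g_m$ the (canonical) duals. (a) Exponential decay. Suppose that for some $\lambda\in(0,1)$, $0<\alpha_1<1$ and some constant $c_1$ we have $|g_m(k)|\le c_1\lambda^{\alpha_1|k|}$ for all $m$ and $k$. Then for every $0<\alpha_2<\alpha_1$ there is a constant $c_2(\alpha_2)$ such that $|S_{k,l}|\le c_2(\alpha_2)\lambda^{\alpha_2|k-l|}$ for all $k,l\in\mathbb Z$. Further, there are an $\alpha_3$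 with $0<\alpha_3<\alpha_1$ and a constant $c_3(\alpha_3)$ such that $|\gamma_m(k)|\le c_3(\alpha_3)\lambda^{\alpha_3|k|}$ for all $m$ and $k$. (b) Polynomial decay. Suppose that for some $\alpha>1$ and some constant $c$ we have $|g_m(k)|\le c(1+|k|)^{-\alpha}$ for all $m$ and $k$. Then there are constants $c_1,c_2$ such that $|S_{k,l}|\le c_1(1+|k-l|)^{-\alpha}$ for all $k,l\in\mathbb Z$ and $|\gamma_m(k)|\le c_2(1+|k|)^{-\alpha}$ for all $m$ and $k$. -/

import Mathlib

noncomputable section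

/-- The Hilbert space `ℓ²(ℤ)` of square summable complex sequences. -/
abbrev SeqSpace : Type := lp (fun _ : ℤ => ℂ) 2

/-- The translate `k ↦ f (k - t)` of `f ∈ ℓ²(ℤ)`. -/
def shiftBy (t : ℤ) (f : SeqSpace) : SeqSpace :=
  ⟨fun k => f (k - t), by
    have hp : 0 < (2 : ENNReal).toReal := by norm_num
    have h := (memℓp_gen_iff hp).1 (lp.memℓp f)
    exact (memℓp_gen_iff hp).2 ((Equiv.subRight t).summable_iff.2 h)⟩

/-- The shift-invariant system `g_{m,n}(k) = g_m(k - n a)`. -/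
def shiftSystem {M : ℕ} (a : ℕ) (g : Fin M → SeqSpace) (p : Fin M × ℤ) : SeqSpace :=
  shiftBy (p.2 * (a : ℤ)) (g p.1)

theorem shiftSystem_apply {M : ℕ} (a : ℕ) (g : Fin M → SeqSpace) (m : Fin M) (n k : ℤ) :
    shiftSystem a g (m, n) k = g m (k - n * (a : ℤ)) := rfl

/-- A family `φ` in `ℓ²(ℤ)` is a frame if there are constants `A, B > 0` with
`A ‖f‖² ≤ ∑ i, |⟨f, φ i⟩|² ≤ B ‖f‖²` for all `f` (the sum being convergent).
Mathlib's inner product is linear in the second argument, so `⟨f, φ i⟩` is `inner ℂ (φ i) f`. -/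
def IsFrame {ι : Type} (φ : ι → SeqSpace) : Prop :=
  ∃ A B : ℝ, 0 < A ∧ 0 < B ∧ ∀ f : SeqSpace,
    Summable (fun i => ‖inner ℂ (φ i) f‖ ^ 2) ∧
      A * ‖f‖ ^ 2 ≤ ∑' i, ‖inner ℂ (φ i) f‖ ^ 2 ∧
      ∑' i, ‖inner ℂ (φ i) f‖ ^ 2 ≤ B * ‖f‖ ^ 2

/-- The frame operator `S f = ∑ i, ⟨f, φ i⟩ φ i`. -/
def frameOperator {ι : Type} (φ : ι → SeqSpace) (f : SeqSpace) : SeqSpace :=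
  ∑' i, (inner ℂ (φ i) f) • φ i

/-- The matrix entries `S_{k,l} = ⟨S e_l, e_k⟩ = (S e_l)(k)` of the frame operator in the standard
basis of `ℓ²(ℤ)`. -/
def frameMatrix {ι : Type} (φ : ι → SeqSpace) (k l : ℤ) : ℂ :=
  frameOperator φ (lp.single 2 l (1 : ℂ)) k

/-- For a frame, the frame operator is (the function underlying) an invertible bounded operator,
and its defining series converges unconditionally in `ℓ²(ℤ)`. -/
theorem IsFrame.exists_clm {ι : Type} {φ : ι → SeqSpace} (h : IsFrame φ) :
    ∃ T : SeqSpace →L[ℂ] SeqSpace, IsUnit T ∧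
      ∀ f, HasSum (fun i => (inner ℂ (φ i) f) • φ i) (T f) := by
  classical
  obtain ⟨A, B, hA, hB, hAB⟩ := h
  have hp : 0 < (2 : ENNReal).toReal := by norm_num
  have hmem : ∀ f : SeqSpace, Memℓp (fun i => (inner ℂ (φ i) f : ℂ)) 2 := fun f =>
    (memℓp_gen_iff hp).2 (by simpa using (hAB f).1)
  let F₀ : SeqSpace →ₗ[ℂ] lp (fun _ : ι => ℂ) 2 :=
    { toFun := fun f => ⟨fun i => inner ℂ (φ i) f, hmem f⟩
      map_add' := fun x y => by
        ext i
        exact inner_add_right (φ i) x y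
      map_smul' := fun c x => by
        ext i
        exact inner_smul_right (φ i) x c }
  have hF₀ : ∀ f, ‖F₀ f‖ ^ 2 = ∑' i, ‖(inner ℂ (φ i) f : ℂ)‖ ^ 2 := fun f => by
    have := lp.norm_rpow_eq_tsum hp (F₀ f)
    simpa [F₀] using this
  let F : SeqSpace →L[ℂ] lp (fun _ : ι => ℂ) 2 :=
    F₀.mkContinuous (Real.sqrt B) fun f => by
      refine le_of_sq_le_sq ?_ (by positivity)
      rw [hF₀, mul_pow, Real.sq_sqrt hB.le]
      exact (hAB f).2.2
  have hFapp : ∀ f i, F f i = inner ℂ (φ i) f := fun f i => rfl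
  have hadj : ∀ i (c : ℂ), (ContinuousLinearMap.adjoint F) (lp.single 2 i c) = c • φ i := by
    intro i c
    refine ext_inner_right ℂ fun f => ?_
    rw [ContinuousLinearMap.adjoint_inner_left, lp.inner_single_left, hFapp, inner_smul_left]
    simp [mul_comm]
  refine ⟨(ContinuousLinearMap.adjoint F).comp F, ?_, fun f => ?_⟩
  · refine ContinuousLinearMap.isUnit_of_forall_le_norm_inner_map _
      (c := ⟨A, hA.le⟩) (by exact_mod_cast hA) fun f => ?_
    rw [ContinuousLinearMap.comp_apply, ContinuousLinearMap.adjoint_inner_left,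
      inner_self_eq_norm_sq_to_K]
    have h1 := (hAB f).2.1
    have h2 : ‖F f‖ ^ 2 = ∑' i, ‖(inner ℂ (φ i) f : ℂ)‖ ^ 2 := hF₀ f
    rw [← h2] at h1
    have h3 : ‖(((‖F f‖ : ℝ) : ℂ)) ^ 2‖ = ‖F f‖ ^ 2 := by simp
    calc ‖f‖ ^ 2 * A = A * ‖f‖ ^ 2 := mul_comm _ _
      _ ≤ ‖F f‖ ^ 2 := h1
      _ = _ := h3.symm
  · have h1 := lp.hasSum_single (p := 2) (by norm_num) (F f)
    have h2 := h1.mapL (ContinuousLinearMap.adjoint F)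
    simpa [hadj, hFapp] using h2

theorem IsFrame.frameOperator_bijective {ι : Type} {φ : ι → SeqSpace} (h : IsFrame φ) :
    Function.Bijective (frameOperator φ) := by
  obtain ⟨T, hT, hs⟩ := h.exists_clm
  have he : frameOperator φ = T := funext fun f => (hs f).tsum_eq
  rw [he]
  exact ContinuousLinearMap.isUnit_iff_bijective.1 hT

/-- The generators `γ_m = S⁻¹ g_m` of the (canonical) dual of a shift-invariant frame. -/
def dualGenerator {M : ℕ} {a : ℕ} {g : Fin M → SeqSpace} (h : IsFrame (shiftSystem a g))
    (m : Fin M) : SeqSpace :=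
  (Equiv.ofBijective _ h.frameOperator_bijective).symm (g m)

theorem frameOperator_dualGenerator {M : ℕ} {a : ℕ} {g : Fin M → SeqSpace}
    (h : IsFrame (shiftSystem a g)) (m : Fin M) :
    frameOperator (shiftSystem a g) (dualGenerator h m) = g m :=
  (Equiv.ofBijective _ h.frameOperator_bijective).apply_symm_apply (g m)

end

/-! The frame bounds make the frame operator `S = b (1 - R)` with `b > 0` and `‖R‖ ≤ r < 1`, so
`γ_m` is the Neumann series of `R` applied to `b⁻¹ g_m`. Decay is measured by weights `φ` with `φ *
φ ≤ D φ`. Matrices dominated by such a weight are closed under products, and applying them to a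
sequence dominated by `φ` keeps it so. The entries of `S` are sums of products of translates of the
`g_m`, so `S` and `R` are dominated directly. What remains is to bound the Neumann partial sums by
one constant times a weight: multiplying entry bounds alone gives the constant `(K D) ^ i` for `R ^
i`, which may grow, while the operator norm gives `r ^ i` but no decay.

Exponential case: a geometric mean of the two bounds gives `ρ ^ i φ ^ t`, with `ρ < 1` for small `t`
(`exists_matBound_rpow_neumann`). The power `t` only lowers the exponential rate, which the theorem
permits.

Polynomial case: the exponent must survive exactly. Squaring an operator with constant `K` and norm
at most `r` costs only `C K ^ (2 - s) r ^ s` (`exists_matBound_sq`). Along `R ^ 2 ^ n` the norm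
bound `r ^ 2 ^ n` beats the growth `(2 - s) ^ n` of the logarithm, so the constants are summable.
The partial sums of length `2 ^ n` are the products of the factors `1 + R ^ 2 ^ i`, `i < n`, and so
stay bounded. -/

open Filter Topology

/-! ### Operators with weight-dominated matrices -/

/-- An even weight on `ℤ` whose convolution square is dominated by a multiple of itself. -/
structure ConvWeight (φ : ℤ → ℝ) (D : ℝ) : Prop where
  nonneg : ∀ k, 0 ≤ φ k
  zero : φ 0 = 1
  even : ∀ k, φ (-k) = φ k
  summable : ∀ k l, Summable fun j => φ (k - j) * φ (j - l)
  tsum_le : ∀ k l, ∑' j, φ (k - j) * φ (j - l) ≤ D * φ (k - l)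

theorem ConvWeight.const_nonneg {φ : ℤ → ℝ} {D : ℝ} (h : ConvWeight φ D) : 0 ≤ D := by
  have h1 := h.tsum_le 0 0
  rw [sub_zero, h.zero, mul_one] at h1
  exact (tsum_nonneg fun j => mul_nonneg (h.nonneg _) (h.nonneg _)).trans h1

/-- The matrix of `A` in the standard basis is dominated by `K φ(k - l)`. -/
def MatBound (φ : ℤ → ℝ) (K : ℝ) (A : SeqSpace →L[ℂ] SeqSpace) : Prop :=
  ∀ k l : ℤ, ‖A (lp.single 2 l (1 : ℂ)) k‖ ≤ K * φ (k - l)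

theorem evalCLM_seqSpace_apply (k : ℤ) (f : SeqSpace) :
    lp.evalCLM ℂ (fun _ : ℤ => ℂ) (2 : ENNReal) k f = f k := rfl

theorem hasSum_apply_entries (A : SeqSpace →L[ℂ] SeqSpace) (f : SeqSpace) (k : ℤ) :
    HasSum (fun j : ℤ => f j * A (lp.single 2 j (1 : ℂ)) k) (A f k) := by
  have h1 := lp.hasSum_single (p := 2) (by norm_num) f
  have h2 := h1.mapL ((lp.evalCLM ℂ (fun _ : ℤ => ℂ) (2 : ENNReal) k).comp A)
  have h3 : ∀ j : ℤ, lp.single (E := fun _ : ℤ => ℂ) 2 j (f j) =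
      f j • lp.single (E := fun _ : ℤ => ℂ) 2 j (1 : ℂ) := fun j => by
    rw [← lp.single_smul]; simp
  simpa [h3, evalCLM_seqSpace_apply] using h2

theorem norm_entry_le_opNorm (A : SeqSpace →L[ℂ] SeqSpace) (k l : ℤ) :
    ‖A (lp.single 2 l (1 : ℂ)) k‖ ≤ ‖A‖ := by
  refine (lp.norm_apply_le_norm two_ne_zero _ k).trans ?_
  have h := A.le_opNorm (lp.single 2 l (1 : ℂ))
  rwa [lp.norm_single (by norm_num), norm_one, mul_one] at h

theorem MatBound.const_nonneg {φ : ℤ → ℝ} {D K : ℝ} {A : SeqSpace →L[ℂ] SeqSpace}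
    (hφ : ConvWeight φ D) (hA : MatBound φ K A) : 0 ≤ K := by
  have h := (norm_nonneg _).trans (hA 0 0)
  rwa [sub_zero, hφ.zero, mul_one] at h

theorem MatBound.norm_apply_le {φ : ℤ → ℝ} {D K c : ℝ} {A : SeqSpace →L[ℂ] SeqSpace}
    (hφ : ConvWeight φ D) (hA : MatBound φ K A) (hc : 0 ≤ c) {f : SeqSpace} {l : ℤ}
    (hf : ∀ j, ‖f j‖ ≤ c * φ (j - l)) (k : ℤ) : ‖A f k‖ ≤ K * c * D * φ (k - l) := by
  have hK := hA.const_nonneg hφ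
  refine ((hasSum_apply_entries A f k).norm_le_of_bounded
    ((hφ.summable k l).hasSum.mul_left (K * c)) fun j => ?_).trans ?_
  · rw [norm_mul]
    calc _ ≤ (c * φ (j - l)) * (K * φ (k - j)) :=
          mul_le_mul (hf j) (hA k j) (norm_nonneg _) (mul_nonneg hc (hφ.nonneg _))
      _ = _ := by ring
  · rw [mul_assoc (K * c)]
    exact mul_le_mul_of_nonneg_left (hφ.tsum_le k l) (mul_nonneg hK hc)

theorem MatBound.mul {φ : ℤ → ℝ} {D K L : ℝ} {A A' : SeqSpace →L[ℂ] SeqSpace}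
    (hφ : ConvWeight φ D) (hA : MatBound φ K A) (hA' : MatBound φ L A') :
    MatBound φ (K * L * D) (A * A') := fun k l =>
  hA.norm_apply_le hφ (hA'.const_nonneg hφ) (fun j => hA' j l) k

theorem MatBound.add {φ : ℤ → ℝ} {K L : ℝ} {A A' : SeqSpace →L[ℂ] SeqSpace}
    (hA : MatBound φ K A) (hA' : MatBound φ L A') : MatBound φ (K + L) (A + A') := fun k l => by
  rw [add_mul]
  exact (norm_add_le _ _).trans (add_le_add (hA k l) (hA' k l))

theorem MatBound.mono {φ ψ : ℤ → ℝ} {K L : ℝ} {A : SeqSpace →L[ℂ] SeqSpace}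
    (hA : MatBound φ K A) (h : ∀ k, K * φ k ≤ L * ψ k) : MatBound ψ L A := fun k l =>
  (hA k l).trans (h _)

theorem matBound_one {φ : ℤ → ℝ} {D : ℝ} (hφ : ConvWeight φ D) : MatBound φ 1 1 := fun k l => by
  rw [one_mul, one_apply_eq_self]
  by_cases h : k = l
  · subst h
    rw [lp.single_apply_self, sub_self, hφ.zero, norm_one]
  · rw [lp.single_apply_ne _ _ _ h, norm_zero]
    exact hφ.nonneg _

theorem matBound_zero {φ : ℤ → ℝ} : MatBound φ 0 0 := fun k l => by
  simp

theorem matBound_sum {φ : ℤ → ℝ} {ι : Type*} (s : Finset ι) {K : ι → ℝ}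
    {A : ι → SeqSpace →L[ℂ] SeqSpace} (h : ∀ i ∈ s, MatBound φ (K i) (A i)) :
    MatBound φ (∑ i ∈ s, K i) (∑ i ∈ s, A i) := by
  classical
  induction s using Finset.induction_on with
  | empty => simpa using matBound_zero
  | insert a s ha ih =>
    rw [Finset.sum_insert ha, Finset.sum_insert ha]
    exact (h a (Finset.mem_insert_self a s)).add
      (ih fun i hi => h i (Finset.mem_insert_of_mem hi))

theorem matBound_pow {φ : ℤ → ℝ} {D K : ℝ} {A : SeqSpace →L[ℂ] SeqSpace}
    (hφ : ConvWeight φ D) (hA : MatBound φ K A) (n : ℕ) : MatBound φ ((K * D) ^ n) (A ^ n) := by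
  induction n with
  | zero => simpa using matBound_one hφ
  | succ n ih =>
    rw [pow_succ, pow_succ, ← mul_assoc]
    exact ih.mul hφ hA

/-! ### Neumann series and the contraction form of the frame operator -/

/-- Decay of a solution of `(1 - R) u = f` from uniform decay of the Neumann partial sums. -/
theorem norm_apply_le_of_neumann {φ : ℤ → ℝ} {D K c r : ℝ} (hφ : ConvWeight φ D)
    {R : SeqSpace →L[ℂ] SeqSpace} (hr : ‖R‖ ≤ r) (hr1 : r < 1)
    (hP : ∀ n, MatBound φ K (∑ i ∈ Finset.range (2 ^ n), R ^ i)) {u f : SeqSpace}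
    (hu : u - R u = f) (hc : 0 ≤ c) (hf : ∀ k, ‖f k‖ ≤ c * φ k) (k : ℤ) :
    ‖u k‖ ≤ K * c * D * φ k := by
  have h1 : ∀ n : ℕ, (∑ i ∈ Finset.range (2 ^ n), R ^ i) f = u - (R ^ (2 ^ n)) u := fun n => by
    have h := congrArg (fun A : SeqSpace →L[ℂ] SeqSpace => A u) (geom_sum_mul_neg R (2 ^ n))
    rw [← hu]
    exact h
  have h0 : Tendsto (fun n : ℕ => R ^ (2 ^ n)) atTop (𝓝 0) :=
    (tendsto_pow_atTop_nhds_zero_of_norm_lt_one (hr.trans_lt hr1)).comp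
      (tendsto_pow_atTop_atTop_of_one_lt one_lt_two)
  have h2 : Tendsto (fun n : ℕ => (u - (R ^ (2 ^ n)) u) k) atTop (𝓝 (u k)) := by
    have h3 := (((ContinuousLinearMap.apply ℂ SeqSpace u).continuous.tendsto 0).comp h0)
    have h4 := tendsto_const_nhds (x := u) |>.sub h3
    have h5 := ((lp.evalCLM ℂ (fun _ : ℤ => ℂ) (2 : ENNReal) k).continuous.tendsto _).comp h4
    simpa [Function.comp_def, evalCLM_seqSpace_apply] using h5
  refine le_of_tendsto h2.norm (Eventually.of_forall fun n => ?_)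
  rw [← h1]
  simpa using (hP n).norm_apply_le hφ hc (l := 0) (by simpa using hf) k

/-- The frame operator, rescaled, is a perturbation of the identity by a strict contraction. -/
theorem IsFrame.exists_contraction {ι : Type} {φ : ι → SeqSpace} (h : IsFrame φ) :
    ∃ (R : SeqSpace →L[ℂ] SeqSpace) (b r : ℝ), 0 < b ∧ 0 < r ∧ r < 1 ∧ ‖R‖ ≤ r ∧
      (∀ f, HasSum (fun i => (inner ℂ (φ i) f : ℂ) • φ i) (frameOperator φ f)) ∧
      ∀ f, frameOperator φ f = (b : ℂ) • (f - R f) := by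
  obtain ⟨T, -, hT⟩ := h.exists_clm
  obtain ⟨A, B, hA, hB, hAB⟩ := h
  have hTeq : ∀ f, frameOperator φ f = T f := fun f => (hT f).tsum_eq
  have hinner : ∀ f g, HasSum (fun i => (inner ℂ (φ i) g : ℂ) * inner ℂ f (φ i))
      (inner ℂ f (T g)) := fun f g => by
    simpa [inner_smul_right] using (hT g).mapL (innerSL ℂ f)
  have hsymm : T.IsSymmetric := fun f g => by
    have h1 := hinner f g
    have h2 := (hinner g f).star
    rw [RCLike.star_def, inner_conj_symm] at h2
    have h3 : (fun i => (starRingEnd ℂ) (inner ℂ (φ i) f * inner ℂ g (φ i))) =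
        fun i => (inner ℂ (φ i) g : ℂ) * inner ℂ f (φ i) := funext fun i => by
      rw [map_mul, inner_conj_symm, inner_conj_symm, mul_comm]
    rw [h3] at h2
    exact h2.unique h1
  have hquad : ∀ f, T.reApplyInnerSelf f = ∑' i, ‖(inner ℂ (φ i) f : ℂ)‖ ^ 2 := fun f => by
    have h1 := (hinner f f).mapL Complex.reCLM
    rw [ContinuousLinearMap.reApplyInnerSelf_apply, inner_re_symm]
    refine h1.tsum_eq.symm.trans (tsum_congr fun i => ?_)
    rw [← inner_conj_symm f (φ i), Complex.reCLM_apply, Complex.mul_conj, Complex.ofReal_re,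
      Complex.normSq_eq_norm_sq]
  have hAleB : A ≤ B := by
    have h1 := hAB (lp.single 2 0 (1 : ℂ))
    rw [lp.norm_single (by norm_num)] at h1
    simpa using h1.2.1.trans h1.2.2
  -- On nonzero vectors the Rayleigh quotients of `R` lie in `[1/2, 1 - A / (2 * B)]`. The factor 2
  -- keeps the bound `r` strictly positive even for a tight frame, where `A = B`.
  set R : SeqSpace →L[ℂ] SeqSpace := 1 - (((2 * B)⁻¹ : ℝ) : ℂ) • T with hR
  refine ⟨R, 2 * B, 1 - A / (2 * B), by positivity, ?_, ?_, ?_, fun f => ?_, fun f => ?_⟩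
  · rw [sub_pos, div_lt_one (by positivity)]; linarith
  · have : 0 < A / (2 * B) := by positivity
    linarith
  · have hRs : R.IsSymmetric :=
      LinearMap.IsSymmetric.one.sub (LinearMap.IsSymmetric.smul (Complex.conj_ofReal _) hsymm)
    rw [R.norm_eq_iSup_rayleighQuotient hRs]
    refine ciSup_le fun f => ?_
    have hq : R.reApplyInnerSelf f = ‖f‖ ^ 2 - (2 * B)⁻¹ * T.reApplyInnerSelf f := by
      rw [hR, ContinuousLinearMap.reApplyInnerSelf_apply,
        ContinuousLinearMap.reApplyInnerSelf_apply, ← inner_self_eq_norm_sq (𝕜 := ℂ)]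
      have h1 : ((1 - (((2 * B)⁻¹ : ℝ) : ℂ) • T : SeqSpace →L[ℂ] SeqSpace)) f =
        f - (((2 * B)⁻¹ : ℝ) : ℂ) • T f := rfl
      rw [h1, inner_sub_left, inner_smul_left, Complex.conj_ofReal, map_sub]
      congr 1
      exact Complex.re_ofReal_mul _ _
    have h1 := (hAB f).2
    rw [← hquad] at h1
    rcases eq_or_ne f 0 with rfl | hf
    · simpa using (div_le_one (by positivity)).2 (by linarith)
    · have hn : 0 < ‖f‖ ^ 2 := by positivity
      have h2 : (2 * B)⁻¹ * (A * ‖f‖ ^ 2) ≤ (2 * B)⁻¹ * T.reApplyInnerSelf f :=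
        mul_le_mul_of_nonneg_left h1.1 (by positivity)
      have h3 : (2 * B)⁻¹ * T.reApplyInnerSelf f ≤ (2 * B)⁻¹ * (B * ‖f‖ ^ 2) :=
        mul_le_mul_of_nonneg_left h1.2 (by positivity)
      have h4 : (2 * B)⁻¹ * (B * ‖f‖ ^ 2) = ‖f‖ ^ 2 / 2 := by field_simp
      have h5 : (2 * B)⁻¹ * (A * ‖f‖ ^ 2) = A / (2 * B) * ‖f‖ ^ 2 := by field_simp
      rw [ContinuousLinearMap.rayleighQuotient, hq, abs_of_nonneg
        (div_nonneg (by linarith) hn.le), div_le_iff₀ hn]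
      linarith
  · rw [hTeq]; exact hT f
  · rw [hTeq, hR]
    have h1 : (1 - (((2 * B)⁻¹ : ℝ) : ℂ) • T : SeqSpace →L[ℂ] SeqSpace) f =
      f - (((2 * B)⁻¹ : ℝ) : ℂ) • T f := rfl
    rw [h1, sub_sub_cancel, smul_smul, ← Complex.ofReal_mul, mul_inv_cancel₀ (by positivity),
      Complex.ofReal_one, one_smul]

/-- Evenness turns each term into a multiple of `φ (k - n a) φ (n a - l)`. Since `n ↦ n a` is
injective, the sum over `n` is part of the full convolution sum. -/
theorem frameMatrix_shiftSystem_norm_le {M a : ℕ} (ha : 0 < a) {g : Fin M → SeqSpace}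
    (hS : ∀ f, HasSum (fun p => (inner ℂ (shiftSystem a g p) f : ℂ) • shiftSystem a g p)
      (frameOperator (shiftSystem a g) f)) {φ : ℤ → ℝ} {D c : ℝ} (hφ : ConvWeight φ D)
    (hc : 0 ≤ c) (hg : ∀ m k, ‖g m k‖ ≤ c * φ k) (k l : ℤ) :
    ‖frameMatrix (shiftSystem a g) k l‖ ≤ M * c ^ 2 * D * φ (k - l) := by
  have h1 := (hS (lp.single 2 l (1 : ℂ))).mapL (lp.evalCLM ℂ (fun _ : ℤ => ℂ) (2 : ENNReal) k)
  have hinj : Function.Injective fun n : ℤ => n * (a : ℤ) :=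
    mul_left_injective₀ (by exact_mod_cast ha.ne')
  have h2 := (hφ.summable k l).comp_injective hinj
  have h3 : ∑' n : ℤ, φ (k - n * a) * φ (n * a - l) ≤ D * φ (k - l) :=
    (tsum_comp_le_tsum_of_inj (hφ.summable k l)
      (fun j => mul_nonneg (hφ.nonneg _) (hφ.nonneg _)) hinj).trans (hφ.tsum_le k l)
  have h4 : HasSum (fun p : Fin M × ℤ => (c ^ 2) * (φ (k - p.2 * a) * φ (p.2 * a - l)))
      (M * (c ^ 2 * ∑' n : ℤ, φ (k - n * a) * φ (n * a - l))) := by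
    have h5 := (hasSum_fintype fun _ : Fin M => (1 : ℝ))
    have h6 := h2.hasSum.mul_left (c ^ 2)
    have h7 := h5.mul h6 (h5.summable.mul_of_nonneg h6.summable (fun _ => zero_le_one)
      fun j => mul_nonneg (sq_nonneg c) (mul_nonneg (hφ.nonneg _) (hφ.nonneg _)))
    simpa [Function.comp_def] using h7
  refine (h1.norm_le_of_bounded h4 fun p => ?_).trans ?_
  · obtain ⟨m, n⟩ := p
    rw [evalCLM_seqSpace_apply, lp.coeFn_smul, Pi.smul_apply, smul_eq_mul, norm_mul,
      lp.inner_single_right, shiftSystem_apply, shiftSystem_apply]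
    have h8 : ‖(inner ℂ (g m (l - n * a)) (1 : ℂ) : ℂ)‖ ≤ c * φ (n * a - l) := by
      rw [← hφ.even, neg_sub]
      simpa using hg m (l - n * a)
    calc _ ≤ (c * φ (n * a - l)) * (c * φ (k - n * a)) :=
          mul_le_mul h8 (hg m _) (norm_nonneg _) (mul_nonneg hc (hφ.nonneg _))
      _ = _ := by ring
  · calc _ ≤ M * (c ^ 2 * (D * φ (k - l))) := by gcongr
      _ = _ := by ring

/-- The data that both decay results need: `S = b (1 - R)` with `R` a strict contraction
dominated by the weight. -/
theorem exists_matBound_contraction {M a : ℕ} (ha : 0 < a) {g : Fin M → SeqSpace}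
    (hg : IsFrame (shiftSystem a g)) {φ : ℤ → ℝ} {D c : ℝ} (hφ : ConvWeight φ D)
    (hc : 0 ≤ c) (hgφ : ∀ m k, ‖g m k‖ ≤ c * φ k) :
    (∀ k l, ‖frameMatrix (shiftSystem a g) k l‖ ≤ M * c ^ 2 * D * φ (k - l)) ∧
    ∃ (R : SeqSpace →L[ℂ] SeqSpace) (b r K : ℝ), 0 < b ∧ 0 < r ∧ r < 1 ∧ ‖R‖ ≤ r ∧
      MatBound φ K R ∧
      ∀ m, dualGenerator hg m - R (dualGenerator hg m) = ((b⁻¹ : ℝ) : ℂ) • g m := by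
  obtain ⟨R, b, r, hb, hr0, hr1, hR, hS, hSR⟩ := hg.exists_contraction
  have hmat := frameMatrix_shiftSystem_norm_le ha hS hφ hc hgφ
  refine ⟨hmat, R, b, r, 1 + b⁻¹ * (M * c ^ 2 * D), hb, hr0, hr1, hR, fun k l => ?_, fun m => ?_⟩
  · have h1 : R (lp.single 2 l (1 : ℂ)) = lp.single 2 l (1 : ℂ) -
        ((b⁻¹ : ℝ) : ℂ) • frameOperator (shiftSystem a g) (lp.single 2 l (1 : ℂ)) := by
      rw [hSR, smul_smul, ← Complex.ofReal_mul, inv_mul_cancel₀ hb.ne', Complex.ofReal_one,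
        one_smul, sub_sub_cancel]
    rw [h1, lp.coeFn_sub, Pi.sub_apply, lp.coeFn_smul, Pi.smul_apply, smul_eq_mul, add_mul]
    refine (norm_sub_le _ _).trans (add_le_add (matBound_one hφ k l) ?_)
    rw [norm_mul, Complex.norm_real, Real.norm_of_nonneg (by positivity), mul_assoc b⁻¹]
    exact mul_le_mul_of_nonneg_left (hmat k l) (by positivity)
  · rw [← frameOperator_dualGenerator hg m, hSR, smul_smul, ← Complex.ofReal_mul,
      inv_mul_cancel₀ hb.ne', Complex.ofReal_one, one_smul]

/-! ### Polynomial and exponential weights -/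

/-- The polynomial weight `(1 + |k|)^(-α)`. -/
noncomputable def polyWeight (α : ℝ) (k : ℤ) : ℝ := (1 + |(k : ℝ)|) ^ (-α)

theorem polyWeight_pos (α : ℝ) (k : ℤ) : 0 < polyWeight α k :=
  Real.rpow_pos_of_pos (by positivity) _

theorem polyWeight_summable {α : ℝ} (hα : 1 < α) : Summable (polyWeight α) := by
  have h1 := Real.summable_abs_int_rpow hα
  -- The comparison series `|k| ^ (-α)` has the default value 0 at `k = 0`, where the weight is 1;
  -- the indicator makes up the difference.
  have h2 : Summable fun k : ℤ => if k = 0 then (1 : ℝ) else 0 :=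
    (hasSum_ite_eq (0 : ℤ) (1 : ℝ)).summable
  refine Summable.of_nonneg_of_le (fun k => (polyWeight_pos α k).le) (fun k => ?_) (h1.add h2)
  by_cases hk : k = 0
  · subst hk
    simp [polyWeight, Real.zero_rpow (by linarith : -α ≠ 0)]
  · rw [if_neg hk, add_zero]
    exact Real.rpow_le_rpow_of_nonpos (by positivity) (by linarith) (by linarith)

theorem polyWeight_le_of_abs_le {α : ℝ} (hα : 0 ≤ α) {x y z : ℤ}
    (h1 : |(z : ℝ)| ≤ |(x : ℝ)| + |(y : ℝ)|) (h2 : |(y : ℝ)| ≤ |(x : ℝ)|) :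
    polyWeight α x ≤ 2 ^ α * polyWeight α z := by
  have h3 : (1 + |(z : ℝ)|) / 2 ≤ 1 + |(x : ℝ)| := by linarith
  have h4 := Real.rpow_le_rpow_of_nonpos (by positivity) h3 (neg_nonpos.2 hα)
  rw [Real.div_rpow (by positivity) (by norm_num), Real.rpow_neg (by norm_num : (0 : ℝ) ≤ 2),
    div_inv_eq_mul, mul_comm] at h4
  exact h4

theorem abs_cast_sub_le (k j l : ℤ) :
    |((k - l : ℤ) : ℝ)| ≤ |((k - j : ℤ) : ℝ)| + |((j - l : ℤ) : ℝ)| := by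
  have := abs_add_le ((k - j : ℤ) : ℝ) ((j - l : ℤ) : ℝ)
  rwa [← Int.cast_add, sub_add_sub_cancel] at this

/-- The larger of `|k - j|` and `|j - l|` is at least `|k - l| / 2`, so its weight is at most `2 ^
α` times that of `k - l`; the other factor is left to be summed over `j`. -/
theorem polyWeight_mul_le {α : ℝ} (hα : 0 ≤ α) (k j l : ℤ) :
    polyWeight α (k - j) * polyWeight α (j - l) ≤
      2 ^ α * polyWeight α (k - l) * (polyWeight α (k - j) + polyWeight α (j - l)) := by
  have htri := abs_cast_sub_le k j l
  have p1 := (polyWeight_pos α (k - j)).le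
  have p2 := (polyWeight_pos α (j - l)).le
  have p3 : 0 ≤ 2 ^ α * polyWeight α (k - l) :=
    mul_nonneg (by positivity) (polyWeight_pos α _).le
  rw [mul_add]
  rcases le_total |((j - l : ℤ) : ℝ)| |((k - j : ℤ) : ℝ)| with h | h
  · have := mul_le_mul_of_nonneg_right (polyWeight_le_of_abs_le hα htri h) p2
    have := mul_nonneg p3 p1
    linarith
  · have := mul_le_mul_of_nonneg_left (polyWeight_le_of_abs_le hα (htri.trans_eq (add_comm _ _)) h) p1
    have := mul_nonneg p3 p2
    linarith

theorem hasSum_translates {φ : ℤ → ℝ} (h : Summable φ) (k l : ℤ) :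
    HasSum (fun j => φ (k - j) + φ (j - l)) (∑' j, φ j + ∑' j, φ j) :=
  ((Equiv.subLeft k).hasSum_iff.2 h.hasSum).add ((Equiv.subRight l).hasSum_iff.2 h.hasSum)

/-- An exponential times a polynomial weight of degree above `1`; `q = 1` is allowed. -/
theorem convWeight_exp_poly {q β α : ℝ} (hq : 0 < q) (hq1 : q ≤ 1) (hβ : 0 ≤ β) (hα : 1 < α) :
    ConvWeight (fun k => q ^ (β * |(k : ℝ)|) * polyWeight α k)
      (2 ^ α * (∑' j, polyWeight α j + ∑' j, polyWeight α j)) := by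
  have hs := fun k l : ℤ => (hasSum_translates (polyWeight_summable hα) k l).mul_left
    (2 ^ α * (q ^ (β * |((k - l : ℤ) : ℝ)|) * polyWeight α (k - l)))
  have hle : ∀ k l j : ℤ, (q ^ (β * |((k - j : ℤ) : ℝ)|) * polyWeight α (k - j)) *
      (q ^ (β * |((j - l : ℤ) : ℝ)|) * polyWeight α (j - l)) ≤
      2 ^ α * (q ^ (β * |((k - l : ℤ) : ℝ)|) * polyWeight α (k - l)) *
        (polyWeight α (k - j) + polyWeight α (j - l)) := fun k l j => by
    have htri := abs_cast_sub_le k j l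
    have h1 : q ^ (β * |((k - j : ℤ) : ℝ)|) * q ^ (β * |((j - l : ℤ) : ℝ)|) ≤
        q ^ (β * |((k - l : ℤ) : ℝ)|) := by
      rw [← Real.rpow_add hq, ← mul_add]
      exact Real.rpow_le_rpow_of_exponent_ge hq hq1 (mul_le_mul_of_nonneg_left htri hβ)
    have h2 := polyWeight_mul_le (by linarith : 0 ≤ α) k j l
    have h3 := mul_le_mul h1 h2 (mul_nonneg (polyWeight_pos _ _).le (polyWeight_pos _ _).le)
      (by positivity)
    refine le_trans (le_of_eq ?_) (h3.trans (le_of_eq ?_)) <;> ring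
  have hnn : ∀ k : ℤ, 0 ≤ q ^ (β * |(k : ℝ)|) * polyWeight α k := fun k =>
    mul_nonneg (by positivity) (polyWeight_pos _ _).le
  have hsum := fun k l : ℤ => Summable.of_nonneg_of_le (fun j => mul_nonneg (hnn _) (hnn _))
    (hle k l) (hs k l).summable
  refine ⟨hnn, by simp [polyWeight], fun k => by simp [polyWeight], hsum, fun k l => ?_⟩
  refine ((hsum k l).tsum_le_tsum (hle k l) (hs k l).summable).trans (le_of_eq ?_)
  rw [(hs k l).tsum_eq]
  ring

theorem convWeight_poly {α : ℝ} (hα : 1 < α) : ConvWeight (polyWeight α)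
    (2 ^ α * (∑' j, polyWeight α j + ∑' j, polyWeight α j)) := by
  simpa using convWeight_exp_poly (q := 1) one_pos le_rfl le_rfl hα

/-- A pure exponential is not a `ConvWeight`: its convolution square gains a factor linear in `|k|`.
A small loss of rate pays for the factor `(1 + |k|) ^ (-2)` that cures this. -/
theorem exists_rpow_le_mul_rpow_mul_polyWeight {q β γ : ℝ} (hq : 0 < q) (hq1 : q < 1)
    (hβγ : β < γ) : ∃ C : ℝ, 0 ≤ C ∧ ∀ k : ℤ,
      q ^ (γ * |(k : ℝ)|) ≤ C * (q ^ (β * |(k : ℝ)|) * polyWeight 2 k) := by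
  -- Chosen so that `exp (ε x) ^ 2 = q ^ ((β - γ) x)`.
  set ε := (γ - β) * (-Real.log q) / 2 with hε
  have hε0 : 0 < ε := by
    have := Real.log_neg hq hq1
    have : 0 < (γ - β) * (-Real.log q) := mul_pos (by linarith) (by linarith)
    positivity
  refine ⟨(1 + 1 / ε) ^ 2, by positivity, fun k => ?_⟩
  set x := |(k : ℝ)| with hx
  have hx0 : 0 ≤ x := abs_nonneg _
  have h1 : 1 + x ≤ (1 + 1 / ε) * Real.exp (ε * x) := by
    have h2 := Real.add_one_le_exp (ε * x)
    calc 1 + x ≤ (1 + 1 / ε) * (ε * x + 1) := by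
          have : (1 + 1 / ε) * (ε * x + 1) = 1 + x + (ε * x + 1 / ε) := by field_simp; ring
          rw [this]
          have : 0 ≤ ε * x + 1 / ε := by positivity
          linarith
      _ ≤ _ := by gcongr
  have h3 : (1 + x) ^ 2 ≤ (1 + 1 / ε) ^ 2 * q ^ ((β - γ) * x) := by
    calc _ ≤ ((1 + 1 / ε) * Real.exp (ε * x)) ^ 2 := by gcongr
      _ = _ := by
        rw [mul_pow, ← Real.exp_nat_mul, Real.rpow_def_of_pos hq]
        congr 2
        rw [hε]; push_cast; ring
  have h4 : polyWeight 2 k = ((1 + x) ^ 2)⁻¹ := by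
    rw [polyWeight, Real.rpow_neg (by positivity)]
    norm_num [hx]
  have h5 : q ^ (γ * x) * q ^ ((β - γ) * x) = q ^ (β * x) := by
    rw [← Real.rpow_add hq]; ring_nf
  rw [h4, ← h5, ← div_eq_mul_inv, ← mul_div_assoc, le_div_iff₀ (by positivity)]
  calc _ ≤ q ^ (γ * x) * ((1 + 1 / ε) ^ 2 * q ^ ((β - γ) * x)) := by gcongr
    _ = _ := by ring

/-! ### Interpolation with the operator norm -/

/-- Each entry is bounded both by the operator norm and by the weight; take the geometric mean with
exponents `1 - t` and `t`. -/
theorem matBound_rpow_of_norm_le {φ : ℤ → ℝ} {D K r t : ℝ} {A : SeqSpace →L[ℂ] SeqSpace}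
    (hφ : ConvWeight φ D) (hA : MatBound φ K A) (hr : ‖A‖ ≤ r) (ht0 : 0 ≤ t) (ht1 : t ≤ 1) :
    MatBound (fun k => φ k ^ t) (r ^ (1 - t) * K ^ t) A := fun k l => by
  have hK := hA.const_nonneg hφ
  have h0 := norm_nonneg (A (lp.single 2 l (1 : ℂ)) k)
  calc ‖A (lp.single 2 l (1 : ℂ)) k‖
      = ‖A (lp.single 2 l (1 : ℂ)) k‖ ^ (1 - t) * ‖A (lp.single 2 l (1 : ℂ)) k‖ ^ t := by
        rw [← Real.rpow_add_of_nonneg h0 (by linarith) ht0, sub_add_cancel, Real.rpow_one]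
    _ ≤ r ^ (1 - t) * (K * φ (k - l)) ^ t :=
        mul_le_mul (Real.rpow_le_rpow h0 ((norm_entry_le_opNorm A k l).trans hr) (by linarith))
          (Real.rpow_le_rpow h0 (hA k l) ht0) (by positivity)
          (Real.rpow_nonneg ((norm_nonneg A).trans hr) _)
    _ = _ := by rw [Real.mul_rpow hK (hφ.nonneg _), mul_assoc]

theorem exists_rpow_mul_rpow_lt_one {r L : ℝ} (hr0 : 0 < r) (hr1 : r < 1) (hL : 0 < L) :
    ∃ t : ℝ, 0 < t ∧ t < 1 ∧ r ^ (1 - t) * L ^ t < 1 := by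
  have hc : ContinuousAt (fun t : ℝ => r ^ (1 - t) * L ^ t) 0 :=
    ((Real.continuous_const_rpow hr0.ne').comp (continuous_const.sub continuous_id)).continuousAt.mul
      (Real.continuous_const_rpow hL.ne').continuousAt
  have h1 : ∀ᶠ t in 𝓝 (0 : ℝ), r ^ (1 - t) * L ^ t < 1 :=
    hc.eventually_lt continuousAt_const (by simpa using hr1)
  have h2 : ∀ᶠ t in 𝓝[>] (0 : ℝ), 0 < t := self_mem_nhdsWithin
  have h3 : ∀ᶠ t in 𝓝 (0 : ℝ), t < 1 := gt_mem_nhds one_pos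
  obtain ⟨t, ⟨ht1, ht2⟩, ht3⟩ :=
    (((h1.and h3).filter_mono nhdsWithin_le_nhds).and h2).exists
  exact ⟨t, ht3, ht2, ht1⟩

/-- The Neumann partial sums of a dominated contraction are dominated by a power of the weight. -/
theorem exists_matBound_rpow_neumann {φ : ℤ → ℝ} {D K r : ℝ} {R : SeqSpace →L[ℂ] SeqSpace}
    (hφ : ConvWeight φ D) (hR : MatBound φ K R) (hr0 : 0 < r) (hr1 : r < 1) (hRr : ‖R‖ ≤ r) :
    ∃ t C : ℝ, 0 < t ∧ t < 1 ∧ 0 ≤ C ∧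
      ∀ N, MatBound (fun k => φ k ^ t) C (∑ i ∈ Finset.range N, R ^ i) := by
  have hKD : 0 ≤ K * D := mul_nonneg (hR.const_nonneg hφ) hφ.const_nonneg
  -- The added 1 keeps the base positive when `K * D = 0`, as continuity of `L ^ t` at `t = 0`
  -- requires.
  have hL : 0 < K * D + 1 := by positivity
  obtain ⟨t, ht0, ht1, ht⟩ := exists_rpow_mul_rpow_lt_one hr0 hr1 hL
  set ρ := r ^ (1 - t) * (K * D + 1) ^ t with hρ
  have hρ0 : 0 ≤ ρ := by positivity
  refine ⟨t, (1 - ρ)⁻¹, ht0, ht1, by rw [inv_nonneg]; linarith, fun N => ?_⟩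
  have h1 : ∀ i : ℕ, MatBound (fun k => φ k ^ t) (ρ ^ i) (R ^ i) := fun i => by
    have h2 : MatBound φ ((K * D + 1) ^ i) (R ^ i) := (matBound_pow hφ hR i).mono fun k =>
      mul_le_mul_of_nonneg_right (pow_le_pow_left₀ hKD (by linarith) i) (hφ.nonneg k)
    have h3 : ‖R ^ i‖ ≤ r ^ i := by
      rcases Nat.eq_zero_or_pos i with rfl | hi
      · rw [pow_zero, pow_zero]
        exact ContinuousLinearMap.norm_id_le
      · exact (norm_pow_le' R hi).trans (pow_le_pow_left₀ (norm_nonneg R) hRr i)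
    have h4 := matBound_rpow_of_norm_le hφ h2 h3 ht0.le ht1.le
    have h5 : (r ^ i) ^ (1 - t) * ((K * D + 1) ^ i) ^ t = ρ ^ i := by
      rw [hρ, mul_pow, Real.rpow_pow_comm hr0.le, Real.rpow_pow_comm hL.le]
    rwa [h5] at h4
  refine (matBound_sum (Finset.range N) fun i _ => h1 i).mono fun k =>
    mul_le_mul_of_nonneg_right ?_ (Real.rpow_nonneg (hφ.nonneg k) t)
  rw [← tsum_geometric_of_lt_one hρ0 ht]
  exact (summable_geometric_of_lt_one hρ0 ht).sum_le_tsum _ fun i _ => by positivity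

/-! ### Norm-controlled squaring for polynomial weights -/

/-- Norm control of squares: the decay constant of `A²` gains a power of the operator norm. -/
theorem exists_matBound_sq {α : ℝ} (hα : 1 < α) : ∃ C s : ℝ, 0 < C ∧ 0 < s ∧ s < 1 ∧
    ∀ (A : SeqSpace →L[ℂ] SeqSpace) (K r : ℝ), 0 < K → ‖A‖ ≤ r → MatBound (polyWeight α) K A →
      MatBound (polyWeight α) (C * K ^ (2 - s) * r ^ s) (A ^ 2) := by
  -- The midpoint of `1/α` and 1: with `α * t > 1` the interpolated weight is still summable, and `s
  -- = 1 - t` is positive.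
  obtain ⟨t, ht0, ht1, hαt⟩ : ∃ t : ℝ, 0 < t ∧ t < 1 ∧ 1 < α * t := by
    refine ⟨(1 + α⁻¹) / 2, by positivity, ?_, ?_⟩
    · have := inv_lt_one_of_one_lt₀ hα
      linarith
    · have : α * α⁻¹ = 1 := mul_inv_cancel₀ (by positivity)
      nlinarith
  have hpow : ∀ k, polyWeight α k ^ t = polyWeight (α * t) k := fun k => by
    rw [polyWeight, polyWeight, ← Real.rpow_mul (by positivity), neg_mul]
  have hsum := polyWeight_summable hαt
  set σ := ∑' j, polyWeight (α * t) j + ∑' j, polyWeight (α * t) j with hσ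
  have hσ0 : 0 < σ := by
    have := hsum.tsum_pos (fun k => (polyWeight_pos _ k).le) 0 (polyWeight_pos _ 0)
    positivity
  refine ⟨2 ^ α * σ, 1 - t, by positivity, by linarith, by linarith,
    fun A K r hK hAr hA k l => ?_⟩
  have hr : 0 ≤ r := (norm_nonneg A).trans hAr
  have hint := matBound_rpow_of_norm_le (convWeight_poly hα) hA hAr ht0.le ht1.le
  simp only [hpow] at hint
  set E := r ^ (1 - t) * K ^ t with hE
  have hE0 : 0 ≤ E := by positivity
  have hp := fun k => (polyWeight_pos α k).le
  have hp' := fun k => (polyWeight_pos (α * t) k).le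
  -- The entry across the larger index gap takes the full bound and yields the weight of `k - l`.
  -- The other takes the interpolated bound `E`, which brings in the norm and is summable in `j`.
  have hbound : ∀ j : ℤ,
      ‖A (lp.single 2 l (1 : ℂ)) j * A (lp.single 2 j (1 : ℂ)) k‖ ≤
        K * (2 ^ α * polyWeight α (k - l)) * E *
          (polyWeight (α * t) (k - j) + polyWeight (α * t) (j - l)) := fun j => by
    have q0 : 0 ≤ K * (2 ^ α * polyWeight α (k - l)) * E :=
      mul_nonneg (mul_nonneg hK.le (mul_nonneg (by positivity) (hp _))) hE0
    rw [norm_mul, mul_add]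
    rcases le_total |((j - l : ℤ) : ℝ)| |((k - j : ℤ) : ℝ)| with h | h
    · have h1 := polyWeight_le_of_abs_le (by linarith : 0 ≤ α) (abs_cast_sub_le k j l) h
      have h2 := mul_le_mul (hint j l) ((hA k j).trans (mul_le_mul_of_nonneg_left h1 hK.le))
        (norm_nonneg _) (mul_nonneg hE0 (hp' _))
      have := mul_nonneg q0 (hp' (k - j))
      linarith
    · have h1 := polyWeight_le_of_abs_le (by linarith : 0 ≤ α)
        ((abs_cast_sub_le k j l).trans_eq (add_comm _ _)) h
      have h2 := mul_le_mul ((hA j l).trans (mul_le_mul_of_nonneg_left h1 hK.le)) (hint k j)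
        (norm_nonneg _) (mul_nonneg hK.le (mul_nonneg (by positivity) (hp _)))
      have := mul_nonneg q0 (hp' (j - l))
      linarith
  have h1 := (hasSum_apply_entries A (A (lp.single 2 l (1 : ℂ))) k).norm_le_of_bounded
    ((hasSum_translates hsum k l).mul_left _) hbound
  rw [pow_two]
  refine h1.trans (le_of_eq ?_)
  have h2 : K ^ (2 - (1 - t)) = K * K ^ t := by
    rw [← Real.rpow_one_add' hK.le (by linarith)]
    ring_nf
  rw [h2, ← hσ, hE]
  ring

/-- Taking logarithms makes the recursion linear. Its solution is led by `2 ^ n * log r`, which is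
negative and outweighs the `(2 - s) ^ n` term. -/
theorem summable_of_superlinear_recursion {C s r : ℝ} (hC : 0 < C) (hs0 : 0 < s) (hs1 : s < 1)
    (hr0 : 0 < r) (hr1 : r < 1) {b : ℕ → ℝ} (hb0 : 0 < b 0)
    (hb : ∀ n, b (n + 1) = C * b n ^ (2 - s) * (r ^ 2 ^ n) ^ s) : Summable b := by
  have hbpos : ∀ n, 0 < b n := fun n => by
    induction n with
    | zero => exact hb0
    | succ n ih => rw [hb]; positivity
  -- `-c` is the fixed point of `x ↦ log C + (2 - s) x`.
  set c := Real.log C / (1 - s) with hc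
  have hlog : ∀ n, Real.log (b n) =
      2 ^ n * Real.log r + (2 - s) ^ n * (Real.log (b 0) - Real.log r + c) - c := fun n => by
    induction n with
    | zero => simp; ring
    | succ n ih =>
      have p1 : b n ^ (2 - s) ≠ 0 := (Real.rpow_pos_of_pos (hbpos n) _).ne'
      have p2 : (r ^ 2 ^ n) ^ s ≠ 0 := by positivity
      have hCc : Real.log C = c * (1 - s) := by
        rw [hc, div_mul_cancel₀ _ (by linarith)]
      rw [hb, Real.log_mul (mul_ne_zero hC.ne' p1) p2, Real.log_mul hC.ne' p1,
        Real.log_rpow (hbpos n), Real.log_rpow (by positivity), Real.log_pow, ih, hCc]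
      push_cast
      ring
  set e := Real.log (b 0) - Real.log r + c with he
  have hlr : Real.log r < 0 := Real.log_neg hr0 hr1
  have hlim : Tendsto (fun n : ℕ => ((2 - s) / 2) ^ n * e - c * (1 / 2) ^ n) atTop (𝓝 0) := by
    have h1 := (tendsto_pow_atTop_nhds_zero_of_lt_one (r := (2 - s) / 2)
      (by linarith) (by linarith)).mul_const e
    have h2 := (tendsto_pow_atTop_nhds_zero_of_lt_one (r := (1 / 2 : ℝ))
      (by norm_num) (by norm_num)).const_mul c
    simpa using h1.sub h2
  -- Half of `2 ^ n * log r` absorbs the lower-order terms; the other half is at most `n * log r /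
  -- 2` because `n ≤ 2 ^ n`.
  have hev : ∀ᶠ n in atTop, b n ≤ (Real.exp (Real.log r / 2)) ^ n := by
    filter_upwards [hlim.eventually_lt_const (by linarith : 0 < -(Real.log r / 2))] with n hn
    have h2n : (0 : ℝ) < 2 ^ n := by positivity
    rw [← Real.exp_nat_mul, ← Real.log_le_iff_le_exp (hbpos n), hlog]
    have h3 := mul_lt_mul_of_pos_left hn h2n
    have h4 : (2 : ℝ) ^ n * (((2 - s) / 2) ^ n * e - c * (1 / 2) ^ n) = (2 - s) ^ n * e - c := by
      rw [div_pow, div_pow, one_pow]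
      field_simp
    have h5 : (n : ℝ) ≤ 2 ^ n := by exact_mod_cast Nat.lt_two_pow_self.le
    have h6 := mul_le_mul_of_nonpos_right h5 (by linarith : Real.log r / 2 ≤ 0)
    rw [h4] at h3
    linarith
  refine Summable.of_norm_bounded_eventually_nat (summable_geometric_of_lt_one (Real.exp_nonneg _)
    (Real.exp_lt_one_iff.2 (by linarith : Real.log r / 2 < 0))) ?_
  filter_upwards [hev] with n hn
  rwa [Real.norm_of_nonneg (hbpos n).le]

/-- The dyadic Neumann partial sums of a polynomially dominated contraction stay dominated by the
same weight. -/
theorem exists_matBound_poly_neumann {α K r : ℝ} (hα : 1 < α) {R : SeqSpace →L[ℂ] SeqSpace}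
    (hR : MatBound (polyWeight α) K R) (hr0 : 0 < r) (hr1 : r < 1) (hRr : ‖R‖ ≤ r) :
    ∃ C : ℝ, ∀ n, MatBound (polyWeight α) C (∑ i ∈ Finset.range (2 ^ n), R ^ i) := by
  have hφ := convWeight_poly hα
  set D := 2 ^ α * (∑' j, polyWeight α j + ∑' j, polyWeight α j)
  have hK := hR.const_nonneg hφ
  obtain ⟨C, s, hC, hs0, hs1, hsq⟩ := exists_matBound_sq hα
  -- The start `K + 1` makes every constant positive, as the squaring estimate requires.
  let b : ℕ → ℝ := Nat.rec (K + 1) fun n x => C * x ^ (2 - s) * (r ^ 2 ^ n) ^ s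
  have hb0 : b 0 = K + 1 := rfl
  have hb : ∀ n, b (n + 1) = C * b n ^ (2 - s) * (r ^ 2 ^ n) ^ s := fun n => rfl
  have hbpos : ∀ n, 0 < b n := fun n => by
    induction n with
    | zero => rw [hb0]; positivity
    | succ n ih => rw [hb]; positivity
  have hsum : Summable b := summable_of_superlinear_recursion hC hs0 hs1 hr0 hr1 (hbpos 0) hb
  have hpow : ∀ n : ℕ, MatBound (polyWeight α) (b n) (R ^ 2 ^ n) := fun n => by
    induction n with
    | zero =>
      rw [pow_zero, pow_one, hb0]
      exact hR.mono fun k => mul_le_mul_of_nonneg_right (by linarith) (hφ.nonneg k)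
    | succ n ih =>
      rw [pow_succ, pow_mul, hb]
      exact hsq _ _ _ (hbpos n) ((norm_pow_le' R (by positivity)).trans
        (pow_le_pow_left₀ (norm_nonneg R) hRr _)) ih
  have hD := hφ.const_nonneg
  have hpart : ∀ n : ℕ, MatBound (polyWeight α) (Real.exp (D * ∑ i ∈ Finset.range n, b i))
      (∑ i ∈ Finset.range (2 ^ n), R ^ i) := fun n => by
    induction n with
    | zero => simpa using matBound_one hφ
    | succ n ih =>
      have h1 : ∑ i ∈ Finset.range (2 ^ (n + 1)), R ^ i =
          ∑ i ∈ Finset.range (2 ^ n), R ^ i +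
            (∑ i ∈ Finset.range (2 ^ n), R ^ i) * R ^ 2 ^ n := by
        rw [pow_succ, mul_two, Finset.sum_range_add, Finset.sum_mul]
        congr 1
        exact Finset.sum_congr rfl fun i _ => by rw [← pow_add, add_comm]
      rw [h1]
      refine (ih.add (ih.mul hφ (hpow n))).mono fun k =>
        mul_le_mul_of_nonneg_right ?_ (hφ.nonneg k)
      -- Doubling the length multiplies the constant by `1 + D * b n ≤ exp (D * b n)`.
      rw [Finset.sum_range_succ, mul_add, Real.exp_add]
      have h2 := mul_le_mul_of_nonneg_left (Real.add_one_le_exp (D * b n))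
        (Real.exp_nonneg (D * ∑ i ∈ Finset.range n, b i))
      linarith
  refine ⟨Real.exp (D * ∑' i, b i), fun n => (hpart n).mono fun k =>
    mul_le_mul_of_nonneg_right (Real.exp_le_exp.2 (mul_le_mul_of_nonneg_left ?_ hD))
      (hφ.nonneg k)⟩
  exact hsum.sum_le_tsum _ fun i _ => (hbpos i).le

/-! ### Decay of the frame matrix and the dual generators -/

theorem norm_dualGenerator_le_of_neumann {M a : ℕ} {g : Fin M → SeqSpace}
    {hg : IsFrame (shiftSystem a g)} {R : SeqSpace →L[ℂ] SeqSpace} {b r : ℝ} (hb : 0 < b)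
    (hr1 : r < 1) (hRr : ‖R‖ ≤ r)
    (hdual : ∀ m, dualGenerator hg m - R (dualGenerator hg m) = ((b⁻¹ : ℝ) : ℂ) • g m)
    {ψ : ℤ → ℝ} {D C c : ℝ} (hψ : ConvWeight ψ D)
    (hP : ∀ n, MatBound ψ C (∑ i ∈ Finset.range (2 ^ n), R ^ i)) (hc : 0 ≤ c)
    (hgψ : ∀ m k, ‖g m k‖ ≤ c * ψ k) (m : Fin M) (k : ℤ) :
    ‖dualGenerator hg m k‖ ≤ C * (b⁻¹ * c) * D * ψ k := by
  refine norm_apply_le_of_neumann hψ hRr hr1 hP (hdual m) (by positivity) (fun j => ?_) k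
  rw [lp.coeFn_smul, Pi.smul_apply, norm_smul, Complex.norm_real,
    Real.norm_of_nonneg (by positivity), mul_assoc]
  exact mul_le_mul_of_nonneg_left (hgψ m j) (by positivity)

theorem rpow_mul_polyWeight_le {q β α : ℝ} (hq : 0 < q) (hα : 0 ≤ α) (k : ℤ) :
    q ^ (β * |(k : ℝ)|) * polyWeight α k ≤ q ^ (β * |(k : ℝ)|) :=
  mul_le_of_le_one_right (by positivity)
    (Real.rpow_le_one_of_one_le_of_nonpos (by linarith [abs_nonneg (k : ℝ)]) (by linarith))

theorem exists_frameMatrix_exp_decay {M a : ℕ} (ha : 0 < a) {g : Fin M → SeqSpace}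
    (hg : IsFrame (shiftSystem a g)) {q α₁ α₂ c₁ : ℝ} (hq : 0 < q) (hq1 : q < 1)
    (hgd : ∀ m k, ‖g m k‖ ≤ c₁ * q ^ (α₁ * |(k : ℝ)|)) (h0 : 0 < α₂) (h1 : α₂ < α₁) :
    ∃ c₂ : ℝ, ∀ k l : ℤ,
      ‖frameMatrix (shiftSystem a g) k l‖ ≤ c₂ * q ^ (α₂ * |(k : ℝ) - (l : ℝ)|) := by
  obtain ⟨C, hC, hCle⟩ := exists_rpow_le_mul_rpow_mul_polyWeight hq hq1 h1
  have hφ := convWeight_exp_poly hq hq1.le h0.le one_lt_two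
  have hgφ : ∀ m k, ‖g m k‖ ≤ |c₁| * C * (q ^ (α₂ * |(k : ℝ)|) * polyWeight 2 k) := fun m k => by
    rw [mul_assoc]
    exact (hgd m k).trans (mul_le_mul (le_abs_self c₁) (hCle k) (by positivity) (abs_nonneg _))
  have hS := (exists_matBound_contraction ha hg hφ (by positivity) hgφ).1
  have hD := hφ.const_nonneg
  refine ⟨M * (|c₁| * C) ^ 2 * (2 ^ (2 : ℝ) * (∑' j, polyWeight 2 j + ∑' j, polyWeight 2 j)),
    fun k l => (hS k l).trans ?_⟩
  rw [← Int.cast_sub]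
  exact mul_le_mul_of_nonneg_left (rpow_mul_polyWeight_le hq two_pos.le _)
    (mul_nonneg (by positivity) hD)

theorem exists_dualGenerator_exp_decay {M a : ℕ} (ha : 0 < a) {g : Fin M → SeqSpace}
    (hg : IsFrame (shiftSystem a g)) {q α₁ c₁ : ℝ} (hq : 0 < q) (hq1 : q < 1) (hα₁ : 0 < α₁)
    (hgd : ∀ m k, ‖g m k‖ ≤ c₁ * q ^ (α₁ * |(k : ℝ)|)) :
    ∃ α₃ : ℝ, 0 < α₃ ∧ α₃ < α₁ ∧ ∃ c₃ : ℝ, ∀ (m : Fin M) (k : ℤ),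
      ‖dualGenerator hg m k‖ ≤ c₃ * q ^ (α₃ * |(k : ℝ)|) := by
  have hgφ : ∀ β, β < α₁ → ∃ c : ℝ, 0 ≤ c ∧
      ∀ m k, ‖g m k‖ ≤ c * (q ^ (β * |(k : ℝ)|) * polyWeight 2 k) := fun β hβ => by
    obtain ⟨C, hC, hCle⟩ := exists_rpow_le_mul_rpow_mul_polyWeight hq hq1 hβ
    refine ⟨|c₁| * C, by positivity, fun m k => ?_⟩
    rw [mul_assoc]
    exact (hgd m k).trans (mul_le_mul (le_abs_self c₁) (hCle k) (by positivity) (abs_nonneg _))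
  -- Any rate strictly between 0 and `α₁` would do; the gap pays for the polynomial factor.
  obtain ⟨c, hc, hgc⟩ := hgφ (α₁ / 2) (by linarith)
  have hφ := convWeight_exp_poly hq hq1.le (by positivity : 0 ≤ α₁ / 2) one_lt_two
  obtain ⟨-, R, b, r, K, hb, hr0, hr1, hRr, hRK, hdual⟩ :=
    exists_matBound_contraction ha hg hφ hc hgc
  obtain ⟨t, L, ht0, ht1, hL, hP⟩ := exists_matBound_rpow_neumann hφ hRK hr0 hr1 hRr
  have hpos : 0 < t * α₁ := mul_pos ht0 hα₁
  have hlt : t * α₁ < α₁ := mul_lt_of_lt_one_left hα₁ ht1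
  -- The power `φ ^ t` need not be a `ConvWeight`. Its polynomial part is discarded, and lowering
  -- the rate from `t * α₁ / 2` to `t * α₁ / 4` buys back a factor of degree 2.
  obtain ⟨C, hC, hCle⟩ := exists_rpow_le_mul_rpow_mul_polyWeight hq hq1
    (by linarith : t * α₁ / 4 < t * α₁ / 2)
  obtain ⟨c', hc', hgc'⟩ := hgφ (t * α₁ / 4) (by linarith)
  have hψ := convWeight_exp_poly hq hq1.le (by positivity : 0 ≤ t * α₁ / 4) one_lt_two
  have hP' : ∀ n, MatBound (fun k => q ^ (t * α₁ / 4 * |(k : ℝ)|) * polyWeight 2 k) (L * C)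
      (∑ i ∈ Finset.range (2 ^ n), R ^ i) := fun n => (hP (2 ^ n)).mono fun k => by
    rw [mul_assoc]
    refine mul_le_mul_of_nonneg_left (le_trans ?_ (hCle k)) hL
    calc _ ≤ (q ^ (α₁ / 2 * |(k : ℝ)|)) ^ t :=
          Real.rpow_le_rpow (hφ.nonneg k) (rpow_mul_polyWeight_le hq two_pos.le k) ht0.le
      _ = _ := by
        rw [← Real.rpow_mul hq.le]
        ring_nf
  have hD := hψ.const_nonneg
  refine ⟨t * α₁ / 4, by positivity, by linarith, _, fun m k =>
    (norm_dualGenerator_le_of_neumann hb hr1 hRr hdual hψ hP' hc' hgc' m k).trans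
      (mul_le_mul_of_nonneg_left (rpow_mul_polyWeight_le hq two_pos.le _) ?_)⟩
  exact mul_nonneg (by positivity) hD

theorem exists_poly_decay {M a : ℕ} (ha : 0 < a) {g : Fin M → SeqSpace}
    (hg : IsFrame (shiftSystem a g)) {α c : ℝ} (hα : 1 < α)
    (hgd : ∀ m k, ‖g m k‖ ≤ c * polyWeight α k) :
    (∃ c₁ : ℝ, ∀ k l, ‖frameMatrix (shiftSystem a g) k l‖ ≤ c₁ * polyWeight α (k - l)) ∧
      ∃ c₂ : ℝ, ∀ m k, ‖dualGenerator hg m k‖ ≤ c₂ * polyWeight α k := by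
  have hφ := convWeight_poly hα
  have hgφ : ∀ m k, ‖g m k‖ ≤ |c| * polyWeight α k := fun m k =>
    (hgd m k).trans (mul_le_mul_of_nonneg_right (le_abs_self c) (hφ.nonneg k))
  obtain ⟨hS, R, b, r, K, hb, hr0, hr1, hRr, hRK, hdual⟩ :=
    exists_matBound_contraction ha hg hφ (abs_nonneg c) hgφ
  obtain ⟨C, hP⟩ := exists_matBound_poly_neumann hα hRK hr0 hr1 hRr
  exact ⟨⟨_, hS⟩, _,
    norm_dualGenerator_le_of_neumann hb hr1 hRr hdual hφ hP (abs_nonneg c) hgφ⟩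

theorem proposition1 (M a : ℕ) (ha : 0 < a) (g : Fin M → SeqSpace)
    (hg : IsFrame (shiftSystem a g)) :
    (∀ q α₁ c₁ : ℝ, 0 < q → q < 1 → 0 < α₁ → α₁ < 1 →
      (∀ (m : Fin M) (k : ℤ), ‖g m k‖ ≤ c₁ * q ^ (α₁ * |(k : ℝ)|)) →
        (∀ α₂ : ℝ, 0 < α₂ → α₂ < α₁ → ∃ c₂ : ℝ, ∀ k l : ℤ,
          ‖frameMatrix (shiftSystem a g) k l‖ ≤ c₂ * q ^ (α₂ * |(k : ℝ) - (l : ℝ)|)) ∧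
        (∃ α₃ : ℝ, 0 < α₃ ∧ α₃ < α₁ ∧ ∃ c₃ : ℝ, ∀ (m : Fin M) (k : ℤ),
          ‖dualGenerator hg m k‖ ≤ c₃ * q ^ (α₃ * |(k : ℝ)|))) ∧
    (∀ α c : ℝ, 1 < α →
      (∀ (m : Fin M) (k : ℤ), ‖g m k‖ ≤ c * (1 + |(k : ℝ)|) ^ (-α)) →
        (∃ c₁ : ℝ, ∀ k l : ℤ,
          ‖frameMatrix (shiftSystem a g) k l‖ ≤ c₁ * (1 + |(k : ℝ) - (l : ℝ)|) ^ (-α)) ∧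
        (∃ c₂ : ℝ, ∀ (m : Fin M) (k : ℤ),
          ‖dualGenerator hg m k‖ ≤ c₂ * (1 + |(k : ℝ)|) ^ (-α))) := by
  refine ⟨fun q α₁ c₁ hq hq1 hα₁ _ hgd =>
    ⟨fun α₂ h0 h1 => exists_frameMatrix_exp_decay ha hg hq hq1 hgd h0 h1,
      exists_dualGenerator_exp_decay ha hg hq hq1 hα₁ hgd⟩, fun α c hα hgd => ?_⟩
  obtain ⟨⟨c₁, h1⟩, h2⟩ := exists_poly_decay ha hg hα hgd
  refine ⟨⟨c₁, fun k l => ?_⟩, h2⟩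
  simpa [polyWeight] using h1 k l
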